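/- For a finite connected simple graph $G$ with distance function $d_G$ and $A\subseteq V(G)$ let $W(A)=\sum_{\{u,v\}\in\binom{A}{2}}d_G(u,v)$. For a function (coloring, not necessarily proper) $f:V(G)\to\{1,\dots,k\}$ let $W(f)=\sum_{i=1}^k W(f^{-1}(i))$, and let $\mathrm{type}(f)$ be the $k$-tuple of the color class sizes $|f^{-1}(1)|,\dots,|f^{-1}(k)|$ arranged in nondecreasing order. A $k$-color weak maximizer of $W$ on $G$ is a surjective $f:V(G)\to\{1,\dots,k\}$ such that $W(f)\ge W(f')$ for every surjective $f':V(G)\to\{1,\dots,k\}$ with $\mathrm{type}(f')=\mathrm{type}(f)$; let $\mathrm{WM}_k(G)$ be the set of these. For a nondecreasing $k$-tuple of integers $x$ and $1\le j\le j'\le k$ let $R_{j,j'}(x)$ be obtained from $x$ by subtracting one from the $j$-th entry, adding one to the $j'$-th entry, and rearranging in nondecreasing order. For a set $T$ of nondecreasing $k$-tuples of integers let $\mathcal R(T)$ be the union of $T$ and the set of all $R_{j,j'}(t)$ with $t=(n_1,\dots,n_k)\in T$, $1\le j\le j'\le k$, and $n_j=n_{j'}$ even; put $\mathcal R^1(T)=\mathcal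 R(T)$, $\mathcal R^{\ell+1}(T)=\mathcal R(\mathcal R^{\ell}(T))$ and $\mathcal R^\infty(T)=\bigcup_{\ell\ge1}\mathcal R^\ell(T)$. For $k\le n$ let $t(n,k)$ be the unique nondecreasing $k$-tuple of positive integers with sum $n$ whose entries pairwise differ by at most one. Let $2\le k\le n$ be integers, let $C_n$ be the cycle on $n$ vertices (a single edge if $n=2$), and let $f:V(C_n)\to\{1,\dots,k\}$ be a $k$-color weak maximizer of $W$ on $C_n$. (1) If $n$ is even, then $W(f)=\min\{W(f'):f'\in\mathrm{WM}_k(C_n)\}$ if and only if $\mathrm{type}(f)\in\mathcal R^\infty(\{t(n,k)\})$. (2) If $n$ is odd, then $W(f)=\min\{W(f'):f'\in\mathrm{WM}_k(C_n)\}$ if and only if the numbers of vertices in any two color classes of $f$ differ by at most one. -/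

import Mathlib

open Finset

/-- The Wiener index of a set `A` of vertices of `G`: the sum of the distances `d_G(u, v)` over all
two-element subsets `{u, v}` of `A`. -/
noncomputable def wienerSet {V : Type*} [DecidableEq V] (G : SimpleGraph V) (A : Finset V) : ℕ :=
  ∑ e ∈ A.sym2 with ¬ e.IsDiag, Sym2.lift ⟨fun u v => G.dist u v, fun _ _ => G.dist_comm⟩ e

/-- The color class `f⁻¹(i)` of a `k`-coloring `f` (the colors are the elements of `Fin k`). -/
def colorClass {V : Type*} [Fintype V] {k : ℕ} (f : V → Fin k) (i : Fin k) : Finset V :=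
  {v | f v = i}

/-- The Wiener index `W(f)` of a coloring: the sum of the Wiener indices of its color classes. -/
noncomputable def wiener {V : Type*} [Fintype V] [DecidableEq V] (G : SimpleGraph V) {k : ℕ}
    (f : V → Fin k) : ℕ :=
  ∑ i, wienerSet G (colorClass f i)

/-- The nondecreasing rearrangement `x^↑` of a tuple of integers. -/
def sortUp {k : ℕ} (x : Fin k → ℤ) : Fin k → ℤ := x ∘ Tuple.sort x

/-- The type of a coloring: the sizes of its color classes in nondecreasing order. -/
def colorType {V : Type*} [Fintype V] {k : ℕ} (f : V → Fin k) : Fin k → ℤ :=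
  sortUp fun i => ((colorClass f i).card : ℤ)

/-- The set `WM_k(G)` of `k`-color weak maximizers of `W` on `G`. -/
def weakMaximizers {V : Type*} [Fintype V] [DecidableEq V] (G : SimpleGraph V) (k : ℕ) :
    Set (V → Fin k) :=
  {f | Function.Surjective f ∧
    ∀ f' : V → Fin k, Function.Surjective f' → colorType f' = colorType f →
      wiener G f' ≤ wiener G f}

/-- The transfer `R_{j,j'}`: subtract one from the `j`-th entry, add one to the `j'`-th entry, and
rearrange in nondecreasing order. -/
def transfer {k : ℕ} (j j' : Fin k) (x : Fin k → ℤ) : Fin k → ℤ :=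
  sortUp (x - Pi.single j 1 + Pi.single j' 1)

/-- The operator `𝓡` on sets of nondecreasing integer tuples: add to `T` all tuples obtained from a
member of `T` by a transfer between two entries that are even and equal. -/
def evenTransferStep {k : ℕ} (T : Set (Fin k → ℤ)) : Set (Fin k → ℤ) :=
  {s | Monotone s ∧
    (s ∈ T ∨ ∃ t ∈ T, ∃ j j' : Fin k, j ≤ j' ∧ Even (t j) ∧ t j = t j' ∧ s = transfer j j' t)}

/-- `𝓡^∞(T)`, the union of the iterates `𝓡^ℓ(T)` over `ℓ ≥ 1`. -/
def evenTransferClosure {k : ℕ} (T : Set (Fin k → ℤ)) : Set (Fin k → ℤ) :=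
  ⋃ l : ℕ, evenTransferStep^[l + 1] T

/-- The equitable tuple `t(n,k)`, with entries `⌊n/k⌋, ⌊(n+1)/k⌋, …, ⌊(n+k-1)/k⌋`; by
`equitableTuple_spec` it is the only nondecreasing `k`-tuple with sum `n` whose entries pairwise
differ by at most one. -/
def equitableTuple (n k : ℕ) : Fin k → ℤ := fun j => (((n + (j : ℕ)) / k : ℕ) : ℤ)

theorem equitableTuple_spec {n k : ℕ} (hk : 1 ≤ k) (hkn : k ≤ n) (t : Fin k → ℤ) :
    ((∀ j, 0 < t j) ∧ ∑ j, t j = n ∧ Monotone t ∧ ∀ j j', |t j - t j'| ≤ 1) ↔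
      t = equitableTuple n k := by
  have hpos : ∀ j, 0 < equitableTuple n k j := fun j => by
    have : 0 < (n + (j : ℕ)) / k := Nat.div_pos (by omega) hk
    unfold equitableTuple
    exact_mod_cast this
  have hmono : Monotone (equitableTuple n k) := fun i j hij => by
    have h : (i : ℕ) ≤ j := hij
    have : (n + (i : ℕ)) / k ≤ (n + (j : ℕ)) / k := Nat.div_le_div_right (by omega)
    unfold equitableTuple
    exact_mod_cast this
  have hdiff : ∀ i j, |equitableTuple n k i - equitableTuple n k j| ≤ 1 := fun i j => by
    have hb : ∀ i : Fin k, n / k ≤ (n + (i : ℕ)) / k ∧ (n + (i : ℕ)) / k ≤ n / k + 1 := fun i => by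
      refine ⟨Nat.div_le_div_right (by omega), ?_⟩
      rw [← Nat.add_div_right n hk]
      exact Nat.div_le_div_right (by omega)
    have h1 := hb i
    have h2 := hb j
    simp only [equitableTuple]
    rw [abs_le]
    omega
  have hsum : ∑ j, equitableTuple n k j = n := by
    have key : ∀ m : ℕ, ∑ j ∈ range k, (m + j) / k = m := fun m => by
      induction m with
      | zero =>
        refine Finset.sum_eq_zero fun j hj => ?_
        simpa using Nat.div_eq_of_lt (Finset.mem_range.1 hj)
      | succ m ih =>
        have h1 := Finset.sum_range_succ (fun j => (m + j) / k) k
        have h2 := Finset.sum_range_succ' (fun j => (m + j) / k) k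
        have h3 : ∑ j ∈ range k, (m + 1 + j) / k = ∑ j ∈ range k, (m + (j + 1)) / k :=
          Finset.sum_congr rfl fun j _ => by rw [add_assoc, add_comm 1 j]
        have h4 := Nat.add_div_right m hk
        simp only [add_zero] at h2
        omega
    have := key n
    rw [← Fin.sum_univ_eq_sum_range (fun j => (n + j) / k) k] at this
    simp only [equitableTuple]
    exact_mod_cast this
  constructor
  · rintro ⟨-, hs, hm, hd⟩
    set e := equitableTuple n k
    by_contra hne
    have hlt : ∃ i, t i < e i := by
      by_contra! h
      have h0 := (Finset.sum_eq_sum_iff_of_le (fun i _ => h i)).1 (hsum.trans hs.symm)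
      exact hne (funext fun i => (h0 i (mem_univ i)).symm)
    have hgt : ∃ j, e j < t j := by
      by_contra! h
      have h0 := (Finset.sum_eq_sum_iff_of_le (fun i _ => h i)).1 (hs.trans hsum.symm)
      exact hne (funext fun i => h0 i (mem_univ i))
    obtain ⟨i, hi⟩ := hlt
    obtain ⟨j, hj⟩ := hgt
    have h1 := (abs_le.1 (hd j i)).2
    have h2 := (abs_le.1 (hdiff i j)).2
    rcases le_total i j with h | h
    · have := hmono h
      omega
    · have := hm h
      omega
  · rintro rfl
    exact ⟨hpos, hsum, hmono, hdiff⟩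

/-! For a starting point `s`, let `σ_s` be `-1` on the half arc at `s` and `1` off it. Counting
separating half arcs gives `4 d(u,v) = ∑ s, (1 - σ_s(u) σ_s(v))`, so `8 W(A) = n|A|² - ∑ s, c_s²`
with `c_s = ∑ u ∈ A, σ_s(u)`. Each `c_s` has the parity of `|A|`. If `|A|` is odd then `c_s² ≥ 1`;
if it is even then `c_s² ≥ 2 c_s`, and `∑ s, c_s = |A| (n % 2)`. This bounds `8 W(A)` by `cycleBound
n |A|`.

For any prescribed sizes all classes can attain the bound at once (`exists_extremal_coloring`):
antipodal pairs do it for even `n`, consecutive blocks in the order `0, h, 2h, …` for `n = 2h + 1`.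
Hence a weak maximizer has `8 W(f) = ∑ i, cycleBound n |f⁻¹(i)|`, and it remains to minimize this
sum over positive tuples with total `n`.

The function `cycleBound n` is convex on `[0, n]`, so balanced tuples are minimal. For odd `n`
convexity is strict in the relevant range and there are no other minimizers. For even `n` it is
affine exactly on the triples `m, m + 1, m + 2` with `m` odd, so the moves preserving the sum trade
`(m + 1, m + 1)` for `(m, m + 2)`: these are the even transfers. -/

/-! ### Distances in the cycle and half arcs -/

/-- The sign of `u` relative to the half arc of length `n / 2` of the cycle starting at `s`: it is
`-1` on the arc and `1` off it. -/
def arcSign {n : ℕ} (s u : Fin n) : ℤ := if (u - s).val < n / 2 then -1 else 1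

theorem cycleGraph_dist_le {n : ℕ} (u v : Fin n) :
    (SimpleGraph.cycleGraph n).dist u v ≤ (v - u).val := by
  induction h : (v - u).val generalizing v with
  | zero =>
    have : u = v := by
      rw [Fin.val_sub] at h
      have := u.2; have := v.2
      apply Fin.ext
      rcases Nat.lt_or_ge (n - u + v) n with h1 | h1
      · rw [Nat.mod_eq_of_lt h1] at h; omega
      · rw [Nat.mod_eq_sub_mod h1, Nat.mod_eq_of_lt (by omega)] at h; omega
    subst this; simp
  | succ j ih =>
    obtain ⟨m, rfl⟩ : ∃ m, n = m + 1 := ⟨n - 1, by have := u.2; omega⟩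
    have hm : 1 ≤ m := by have := (v - u).2; omega
    have h1 : ((1 : Fin (m + 1)) : ℕ) = 1 := by
      rw [Fin.val_one']; exact Nat.mod_eq_of_lt (by omega)
    have h2 : (v - 1 - u).val = j := by
      have e : v - 1 - u = (v - u) - 1 := by abel
      rw [e, Fin.sub_val_of_le, h, h1]
      · rfl
      · rw [Fin.le_def, h, h1]; omega
    have h3 : (SimpleGraph.cycleGraph (m + 1)).Adj (v - 1) v := by
      rw [SimpleGraph.cycleGraph_adj']
      right
      rw [sub_sub_cancel, h1]
    calc _ ≤ (SimpleGraph.cycleGraph (m + 1)).dist u (v - 1) +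
          (SimpleGraph.cycleGraph (m + 1)).dist (v - 1) v :=
        SimpleGraph.cycleGraph_connected.dist_triangle
      _ ≤ j + 1 := by
        rw [SimpleGraph.dist_eq_one_iff_adj.2 h3]
        exact Nat.add_le_add_right (ih _ h2) 1

theorem fin_val_sub_eq {n : ℕ} (u v : Fin n) :
    (u - v).val = if v.val ≤ u.val then u.val - v.val else n + u.val - v.val := by
  rw [Fin.val_sub]
  have := u.2; have := v.2
  split_ifs with h
  · rw [Nat.mod_eq_sub_mod (by omega), Nat.mod_eq_of_lt (by omega)]; omega
  · rw [Nat.mod_eq_of_lt (by omega)]; omega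

/-- Crossing an edge changes the cyclic distance to the endpoint by at most one. -/
theorem le_walk_length_cycleGraph {n : ℕ} {u v : Fin n} (w : (SimpleGraph.cycleGraph n).Walk u v) :
    min (v - u).val (u - v).val ≤ w.length := by
  induction w with
  | nil => simp [fin_val_sub_eq]
  | @cons a b c h p ih =>
    rw [SimpleGraph.cycleGraph_adj'] at h
    rw [SimpleGraph.Walk.length_cons]
    simp only [fin_val_sub_eq] at *
    have := a.2; have := b.2; have := c.2
    split_ifs at * <;> omega

/-- The distance function of the cycle. -/
theorem cycleGraph_dist {n : ℕ} (u v : Fin n) :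
    (SimpleGraph.cycleGraph n).dist u v = min (v - u).val (u - v).val := by
  apply le_antisymm
  · refine le_min (cycleGraph_dist_le u v) ?_
    rw [SimpleGraph.dist_comm]
    exact cycleGraph_dist_le v u
  · obtain ⟨w, hw⟩ := (SimpleGraph.cycleGraph_preconnected u v).exists_walk_length_eq_dist
    rw [← hw]
    exact le_walk_length_cycleGraph w

/-- Here `r` is the position of the first vertex relative to the start of the arc, and `d` the
forward offset of the second. The separating positions form two intervals of length `min d (n - d)`,
and each position contributes `2`. -/
theorem sum_separating_range {n d : ℕ} (hd : d < n) :
    ∑ r ∈ range n, (1 - (if r < n / 2 then -1 else 1) *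
      (if (if r + d < n then r + d else r + d - n) < n / 2 then -1 else 1) : ℤ) =
      4 * (min d (n - d) : ℕ) := by
  have key : ∀ r ∈ range n, (1 - (if r < n / 2 then -1 else 1) *
      (if (if r + d < n then r + d else r + d - n) < n / 2 then -1 else 1) : ℤ) =
      if r ∈ (if d ≤ n / 2 then Ico (n / 2 - d) (n / 2) ∪ Ico (n - d) n
        else Ico 0 (n - d) ∪ Ico (n / 2) (n + n / 2 - d)) then 2 else 0 := by
    intro r hr
    rw [mem_range] at hr
    by_cases hdn : d ≤ n / 2
    · simp only [hdn, if_true, mem_union, mem_Ico]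
      split_ifs <;> first | rfl | omega
    · simp only [hdn, if_false, mem_union, mem_Ico]
      split_ifs <;> first | rfl | omega
  rw [sum_congr rfl key, ← sum_filter, sum_const, filter_mem_eq_inter, inter_eq_right.2]
  · split_ifs with h
    · rw [card_union_of_disjoint, Nat.card_Ico, Nat.card_Ico]
      · simp only [nsmul_eq_mul]; push_cast; omega
      · rw [disjoint_left]; intro x; simp only [mem_Ico]; omega
    · rw [card_union_of_disjoint, Nat.card_Ico, Nat.card_Ico]
      · simp only [nsmul_eq_mul]; push_cast; omega
      · rw [disjoint_left]; intro x; simp only [mem_Ico]; omega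
  · intro r
    split_ifs <;> simp only [mem_union, mem_Ico, mem_range] <;> omega

/-- Four times the distance counts, with weight two, the half arcs separating the two vertices. -/
theorem four_mul_cycleGraph_dist {n : ℕ} (u v : Fin n) :
    4 * ((SimpleGraph.cycleGraph n).dist u v : ℤ) = ∑ s, (1 - arcSign s u * arcSign s v) := by
  obtain ⟨m, rfl⟩ : ∃ m, n = m + 1 := ⟨n - 1, by have := u.2; omega⟩
  have h1 : min (v - u).val (u - v).val = min (v - u).val (m + 1 - (v - u).val) := by
    have := u.2; have := v.2
    simp only [fin_val_sub_eq]
    split_ifs <;> omega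
  rw [cycleGraph_dist, h1, ← sum_separating_range (v - u).2, ← Fin.sum_univ_eq_sum_range
    (fun r => (1 - (if r < (m + 1) / 2 then -1 else 1) *
      (if (if r + (v - u).val < m + 1 then r + (v - u).val else r + (v - u).val - (m + 1)) <
        (m + 1) / 2 then -1 else 1) : ℤ)), ← Equiv.sum_comp (Equiv.subLeft u)]
  refine sum_congr rfl fun s _ => ?_
  simp only [Equiv.subLeft_apply, arcSign]
  congr 4
  have := u.2; have := v.2; have := s.2
  simp only [fin_val_sub_eq]
  split_ifs <;> omega

theorem sum_arcSign {n : ℕ} (u : Fin n) : ∑ s, arcSign s u = (n % 2 : ℕ) := by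
  obtain ⟨m, rfl⟩ : ∃ m, n = m + 1 := ⟨n - 1, by have := u.2; omega⟩
  rw [← Equiv.sum_comp (Equiv.subLeft u)]
  simp only [Equiv.subLeft_apply, arcSign, sub_sub_cancel]
  rw [Fin.sum_univ_eq_sum_range (fun r => (if r < (m + 1) / 2 then -1 else 1 : ℤ)), sum_ite,
    sum_const, sum_const]
  have e1 : {r ∈ range (m + 1) | r < (m + 1) / 2} = range ((m + 1) / 2) := by
    ext; simp only [mem_filter, mem_range]; omega
  have e2 : {r ∈ range (m + 1) | ¬ r < (m + 1) / 2} = Ico ((m + 1) / 2) (m + 1) := by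
    ext; simp only [mem_filter, mem_range, mem_Ico]; omega
  rw [e1, e2, card_range, Nat.card_Ico]
  simp only [nsmul_eq_mul]
  omega

/-! ### The largest Wiener index of a set of given size -/

theorem two_mul_wienerSet {n : ℕ} (G : SimpleGraph (Fin n)) (A : Finset (Fin n)) :
    2 * wienerSet G A = ∑ u ∈ A, ∑ v ∈ A, G.dist u v := by
  rw [wienerSet, sum_sym2_filter_not_isDiag, ← sum_product', ← diag_union_offDiag,
    sum_union (disjoint_diag_offDiag A)]
  have h0 : ∑ x ∈ A.diag, G.dist x.1 x.2 = 0 :=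
    sum_eq_zero fun x hx => by rw [(mem_diag.1 hx).2]; simp
  rw [h0, zero_add, ← sum_filter_add_sum_filter_not A.offDiag (fun x => x.1 < x.2), two_mul]
  congr 1
  refine sum_nbij' Prod.swap Prod.swap ?_ ?_ ?_ ?_ ?_
  · intro x; simp only [mem_filter, mem_offDiag]
    rintro ⟨⟨h1, h2, h3⟩, h4⟩
    exact ⟨⟨h2, h1, h3.symm⟩, not_lt.2 h4.le⟩
  · intro x; simp only [mem_filter, mem_offDiag]
    rintro ⟨⟨h1, h2, h3⟩, h4⟩
    exact ⟨⟨h2, h1, h3.symm⟩, lt_of_le_of_ne (not_lt.1 h4) h3.symm⟩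
  · intro x _; rfl
  · intro x _; rfl
  · intro x _; exact G.dist_comm

theorem eight_mul_wienerSet {n : ℕ} (A : Finset (Fin n)) :
    8 * (wienerSet (SimpleGraph.cycleGraph n) A : ℤ) =
      n * (A.card : ℤ) ^ 2 - ∑ s, (∑ u ∈ A, arcSign s u) ^ 2 := by
  have h := congrArg (Nat.cast : ℕ → ℤ) (two_mul_wienerSet (SimpleGraph.cycleGraph n) A)
  push_cast at h
  have h2 : 8 * (wienerSet (SimpleGraph.cycleGraph n) A : ℤ) =
      4 * (2 * (wienerSet (SimpleGraph.cycleGraph n) A : ℤ)) := by ring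
  rw [h2, h, mul_sum]
  simp only [mul_sum, four_mul_cycleGraph_dist, sum_sub_distrib, sum_const, card_univ,
    Fintype.card_fin, nsmul_eq_mul, mul_one]
  congr 1
  · ring
  · rw [sum_congr rfl fun u _ => sum_comm, sum_comm]
    refine sum_congr rfl fun s _ => ?_
    rw [sq, sum_mul_sum]

/-- Eight times the largest Wiener index of a set of `m` vertices of the `n`-cycle. -/
def cycleBound (n m : ℕ) : ℤ := n * (m : ℤ) ^ 2 - if Odd m then (n : ℤ) else 2 * m * (n % 2 : ℕ)

theorem even_card_sub_sum_arcSign {n : ℕ} (A : Finset (Fin n)) (s : Fin n) :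
    Even ((A.card : ℤ) - ∑ u ∈ A, arcSign s u) := by
  rw [card_eq_sum_ones]
  push_cast
  rw [← sum_sub_distrib]
  refine even_sum _ fun u _ => ?_
  unfold arcSign
  split_ifs <;> decide

theorem sum_sum_arcSign {n : ℕ} (A : Finset (Fin n)) :
    ∑ s, ∑ u ∈ A, arcSign s u = A.card * (n % 2 : ℕ) := by
  rw [sum_comm, sum_congr rfl fun u _ => sum_arcSign u, sum_const, nsmul_eq_mul]

theorem eight_mul_wienerSet_le {n : ℕ} (A : Finset (Fin n)) :
    8 * (wienerSet (SimpleGraph.cycleGraph n) A : ℤ) ≤ cycleBound n A.card := by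
  rw [eight_mul_wienerSet, cycleBound]
  refine sub_le_sub_left ?_ _
  split_ifs with h
  · calc (n : ℤ) = ∑ s : Fin n, 1 := by simp
      _ ≤ _ := sum_le_sum fun s _ => by
        have h1 := even_card_sub_sum_arcSign A s
        have h2 : (∑ u ∈ A, arcSign s u) ≠ 0 := by
          intro h0
          rw [h0, sub_zero, Int.even_coe_nat] at h1
          exact Nat.not_even_iff_odd.2 h h1
        have h3 : 0 < (∑ u ∈ A, arcSign s u) ^ 2 := by positivity
        exact h3
  · calc (2 * (A.card : ℤ) * (n % 2 : ℕ)) = ∑ s, 2 * ∑ u ∈ A, arcSign s u := by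
          rw [← mul_sum, sum_sum_arcSign]; ring
      _ ≤ _ := sum_le_sum fun s _ => by
        obtain ⟨a, ha⟩ := even_card_sub_sum_arcSign A s
        obtain ⟨b, hb⟩ := Nat.not_odd_iff_even.1 h
        have hc : ∑ u ∈ A, arcSign s u = 2 * (b - a) := by rw [hb] at ha; push_cast at ha; omega
        rw [hc]
        -- With `z = b - a` the claim is `4z ≤ 4z²`, true for every integer.
        rcases le_or_gt ((b : ℤ) - a) 0 with h0 | h0 <;> nlinarith

/-- A set whose intersections with the half arcs are balanced attains the bound. -/
theorem eight_mul_wienerSet_eq {n : ℕ} (A : Finset (Fin n))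
    (hodd : Odd A.card → ∀ s, (∑ u ∈ A, arcSign s u) ^ 2 = 1)
    (heven : Even A.card → ∀ s, (∑ u ∈ A, arcSign s u) ^ 2 = 2 * ∑ u ∈ A, arcSign s u) :
    8 * (wienerSet (SimpleGraph.cycleGraph n) A : ℤ) = cycleBound n A.card := by
  rw [eight_mul_wienerSet, cycleBound]
  congr 1
  split_ifs with h
  · rw [sum_congr rfl fun s _ => hodd h s]; simp
  · rw [sum_congr rfl fun s _ => heven (Nat.not_odd_iff_even.1 h) s, ← mul_sum, sum_sum_arcSign]
    ring

/-! ### Extremal colorings of even cycles -/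

theorem sum_colorClass {n k : ℕ} (f : Fin n → Fin k) (i : Fin k) (g : Fin n → ℤ) :
    ∑ v ∈ colorClass f i, g v = ∑ v, if f v = i then g v else 0 := by
  rw [colorClass, sum_filter]

theorem card_colorClass {n k : ℕ} (f : Fin n → Fin k) (i : Fin k) :
    ((colorClass f i).card : ℤ) = ∑ v, if f v = i then 1 else 0 := by
  rw [← sum_colorClass]; simp

theorem arcSign_natAdd {h : ℕ} (s : Fin (h + h)) (t : Fin h) :
    arcSign s (Fin.natAdd h t) = - arcSign s (Fin.castAdd h t) := by
  unfold arcSign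
  have := s.2; have := t.2
  simp only [fin_val_sub_eq, Fin.val_natAdd, Fin.val_castAdd]
  split_ifs <;> omega

/-- `h` antipodal pairs can be colored with prescribed even total such that every color is
unbalanced on at most one pair. -/
theorem exists_paired_coloring {k : ℕ} (h : ℕ) (m : Fin k → ℕ) (hm : ∑ i, m i = h + h) :
    ∃ g₁ g₂ : Fin h → Fin k, ∀ i,
      (m i : ℤ) = ∑ t, ((if g₁ t = i then 1 else 0) + (if g₂ t = i then 1 else 0)) ∧
      ∑ t, |((if g₁ t = i then 1 else 0) - (if g₂ t = i then 1 else 0) : ℤ)| ≤ 1 := by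
  induction h generalizing m with
  | zero =>
    refine ⟨Fin.elim0, Fin.elim0, fun i => ?_⟩
    have : m i = 0 := (sum_eq_zero_iff.1 hm) i (mem_univ i)
    simp [this]
  | succ h ih =>
    -- A color with two vertices left takes a whole pair and stays balanced there. Otherwise all
    -- counts are at most one, and two different colors share the pair.
    by_cases hex : ∃ i, 2 ≤ m i
    · obtain ⟨i, hi⟩ := hex
      obtain ⟨g₁, g₂, hg⟩ := ih (fun j => m j - if j = i then 2 else 0) (by
        have h1 : ∑ j, ((m j - if j = i then 2 else 0) + if j = i then 2 else 0) = ∑ j, m j := by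
          refine sum_congr rfl fun j _ => ?_
          split_ifs with hj
          · subst hj; omega
          · omega
        rw [sum_add_distrib, sum_ite_eq' univ i, if_pos (mem_univ i)] at h1
        omega)
      refine ⟨Fin.cons i g₁, Fin.cons i g₂, fun j => ?_⟩
      obtain ⟨h1, h2⟩ := hg j
      simp only [Fin.sum_univ_succ, Fin.cons_zero, Fin.cons_succ]
      refine ⟨?_, by simpa using h2⟩
      rw [← h1]
      by_cases hj : j = i
      · subst hj; simp; omega
      · simp [hj, Ne.symm hj]
    · push Not at hex
      have hpos : ∃ i, m i ≠ 0 := by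
        by_contra! h0
        simp [h0] at hm
      obtain ⟨i, hi⟩ := hpos
      have hi1 : m i = 1 := by have := hex i; omega
      have hpos2 : ∃ j, j ≠ i ∧ m j ≠ 0 := by
        by_contra! h0
        rw [sum_eq_single i (fun j _ hj => h0 j hj) (by simp)] at hm
        omega
      obtain ⟨j, hji, hj⟩ := hpos2
      have hj1 : m j = 1 := by have := hex j; omega
      obtain ⟨g₁, g₂, hg⟩ := ih
        (fun l => m l - ((if l = i then 1 else 0) + if l = j then 1 else 0)) (by
        have h1 : ∑ l, ((m l - ((if l = i then 1 else 0) + if l = j then 1 else 0)) +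
            ((if l = i then 1 else 0) + if l = j then 1 else 0)) = ∑ l, m l := by
          refine sum_congr rfl fun l _ => ?_
          split_ifs with h1 h2 h2
          · exact absurd (h2.symm.trans h1) hji
          · subst h1; omega
          · subst h2; omega
          · omega
        rw [sum_add_distrib, sum_add_distrib (f := fun l => if l = i then 1 else 0),
          sum_ite_eq' univ i, sum_ite_eq' univ j, if_pos (mem_univ i), if_pos (mem_univ j)] at h1
        omega)
      -- Both colors are now used up, so this pair is the only one on which they are unbalanced.
      have hzero : ∀ l, (l = i ∨ l = j) → ∀ t, g₁ t ≠ l ∧ g₂ t ≠ l := by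
        intro l hl t
        have h1 := (hg l).1
        have h0 : m l - ((if l = i then 1 else 0) + if l = j then 1 else 0) = 0 := by
          rcases hl with rfl | rfl <;> simp <;> omega
        rw [h0, Nat.cast_zero, eq_comm, sum_eq_zero_iff_of_nonneg] at h1
        · have h2 := h1 t (mem_univ t)
          constructor
          · intro h3; rw [if_pos h3] at h2; split_ifs at h2 <;> omega
          · intro h3; rw [if_pos h3] at h2; split_ifs at h2 <;> omega
        · intro t _; split_ifs <;> norm_num
      refine ⟨Fin.cons i g₁, Fin.cons j g₂, fun l => ?_⟩
      obtain ⟨h1, h2⟩ := hg l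
      simp only [Fin.sum_univ_succ, Fin.cons_zero, Fin.cons_succ]
      by_cases hl : l = i ∨ l = j
      · have hz := hzero l hl
        simp only [hz, if_false, sub_self, abs_zero, sum_const_zero, add_zero]
        rcases hl with rfl | rfl
        · simp [hji, hi1]
        · simp [Ne.symm hji, hj1]
      · push Not at hl
        simp only [hl.1.symm, hl.2.symm, if_false]
        refine ⟨?_, by simpa using h2⟩
        rw [← h1]
        simp [hl.1, hl.2]

/-- Antipodal vertices have opposite signs, so a class is unbalanced by at most one on every half
arc; parity then makes each `c_s` equal to `±1` or `0`. -/
theorem exists_extremal_coloring_even {k h : ℕ} (m : Fin k → ℕ) (hm : ∑ i, m i = h + h) :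
    ∃ f : Fin (h + h) → Fin k, ∀ i, (colorClass f i).card = m i ∧
      8 * (wienerSet (SimpleGraph.cycleGraph (h + h)) (colorClass f i) : ℤ) =
        cycleBound (h + h) (m i) := by
  obtain ⟨g₁, g₂, hg⟩ := exists_paired_coloring h m hm
  refine ⟨Fin.append g₁ g₂, fun i => ?_⟩
  obtain ⟨h1, h2⟩ := hg i
  have hcard : (colorClass (Fin.append g₁ g₂) i).card = m i := by
    zify
    rw [card_colorClass, h1, Fin.sum_univ_add, sum_add_distrib]
    simp only [Fin.append_left, Fin.append_right]
  refine ⟨hcard, ?_⟩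
  have habs : ∀ s, |∑ v ∈ colorClass (Fin.append g₁ g₂) i, arcSign s v| ≤ 1 := by
    intro s
    rw [sum_colorClass, Fin.sum_univ_add, ← sum_add_distrib]
    refine (abs_sum_le_sum_abs _ _).trans (le_trans (sum_le_sum fun t _ => ?_) h2)
    simp only [Fin.append_left, Fin.append_right, arcSign_natAdd]
    have : arcSign s (Fin.castAdd h t) = 1 ∨ arcSign s (Fin.castAdd h t) = -1 := by
      unfold arcSign; split_ifs <;> simp
    rcases this with h0 | h0 <;> rw [h0] <;> split_ifs <;> norm_num
  have hpar := even_card_sub_sum_arcSign (colorClass (Fin.append g₁ g₂) i)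
  rw [← hcard]
  refine eight_mul_wienerSet_eq _ (fun ho s => ?_) (fun he s => ?_)
  · obtain ⟨a, ha⟩ := hpar s
    obtain ⟨b, hb⟩ := ho
    have := abs_le.1 (habs s)
    have h3 : ∑ v ∈ colorClass (Fin.append g₁ g₂) i, arcSign s v = 1 ∨
        ∑ v ∈ colorClass (Fin.append g₁ g₂) i, arcSign s v = -1 := by omega
    rcases h3 with h3 | h3 <;> rw [h3] <;> rfl
  · obtain ⟨a, ha⟩ := hpar s
    obtain ⟨b, hb⟩ := he
    have := abs_le.1 (habs s)
    have h3 : ∑ v ∈ colorClass (Fin.append g₁ g₂) i, arcSign s v = 0 := by omega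
    rw [h3]; rfl

/-! ### Extremal colorings of odd cycles -/

/-- The position of `v` in the ordering `0, h, 2h, …` of the vertices of the cycle with `2h + 1`
vertices. -/
def oddOrder (h : ℕ) (v : Fin (2 * h + 1)) : Fin (2 * h + 1) :=
  ⟨if v.val = 0 then 0 else if v.val ≤ h then 2 * h + 1 - 2 * v.val
    else 2 * (2 * h + 1) - 2 * v.val, by have := v.2; split_ifs <;> omega⟩

/-- The position of `v` is `-2v` modulo `2h + 1`, because `2h ≡ -1`; and `2` is a unit. -/
theorem oddOrder_bijective (h : ℕ) : Function.Bijective (oddOrder h) := by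
  refine Finite.injective_iff_bijective.1 fun u v huv => ?_
  have h1 := congrArg Fin.val huv
  have := u.2; have := v.2
  simp only [oddOrder] at h1
  apply Fin.ext
  split_ifs at h1 <;> omega

/-- The signs of the half arcs in the ordering `oddOrder`: they alternate, except for two equal
consecutive signs `1` at the positions `c - 1` and `c`. -/
def alternatingSign (c x : ℕ) : ℤ :=
  if x < c then (if x % 2 = c % 2 then -1 else 1) else (if x % 2 = c % 2 then 1 else -1)

/-- A step by `h` switches between the arc and its complement, except from `s + h` to `s + 2h = s -
1`, both off the arc. So `c` is the position of `s - 1`, that is `2 - 2s` modulo `2h + 1`; for `c =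
0` the repetition falls at the wrap-around and is not seen. -/
theorem exists_arcSign_eq_alternatingSign {h : ℕ} (hh : 1 ≤ h) (s : Fin (2 * h + 1)) :
    ∃ c, ∀ v, arcSign s v = alternatingSign c (oddOrder h v) := by
  refine ⟨if s.val = 1 then 0 else if s.val = 0 then 2 else if s.val ≤ h + 1 then
    2 * h + 3 - 2 * s.val else 2 * (2 * h + 1) + 2 - 2 * s.val, fun v => ?_⟩
  have := s.2; have := v.2
  simp only [arcSign, alternatingSign, oddOrder, fin_val_sub_eq]
  have e : (2 * h + 1) / 2 = h := by omega
  rw [e]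
  split_ifs <;> first | rfl | omega

theorem sum_range_alternatingSign (c x : ℕ) :
    ∑ y ∈ range x, alternatingSign c y =
      if x ≤ c then (if x % 2 = 0 then (0 : ℤ) else if c % 2 = 0 then -1 else 1)
      else ((c % 2 + (x - c) % 2 : ℕ) : ℤ) := by
  induction x with
  | zero => simp
  | succ x ih =>
    rw [sum_range_succ, ih, alternatingSign]
    split_ifs <;> omega

theorem sum_alternatingSign_odd (c a : ℕ) {m : ℕ} (hm : Odd m) :
    (∑ t ∈ range m, alternatingSign c (a + t)) ^ 2 = 1 := by
  have h1 := sum_range_add (alternatingSign c) a m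
  obtain ⟨b, rfl⟩ := hm
  rw [sum_range_alternatingSign, sum_range_alternatingSign] at h1
  have h3 : ∑ t ∈ range (2 * b + 1), alternatingSign c (a + t) = 1 ∨
      ∑ t ∈ range (2 * b + 1), alternatingSign c (a + t) = -1 := by
    split_ifs at h1 <;> omega
  rcases h3 with h3 | h3 <;> rw [h3] <;> rfl

/-- A window containing the repeated `1, 1` splits there into two alternating pieces, each of sum
`0` or `1`, with lengths of equal parity. The value `-2` never occurs, and `0` and `2` are the
equality cases of `c² ≥ 2c`. -/
theorem sum_alternatingSign_even (c a : ℕ) {m : ℕ} (hm : Even m) :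
    (∑ t ∈ range m, alternatingSign c (a + t)) ^ 2 =
      2 * ∑ t ∈ range m, alternatingSign c (a + t) := by
  have h1 := sum_range_add (alternatingSign c) a m
  obtain ⟨b, rfl⟩ := hm
  rw [sum_range_alternatingSign, sum_range_alternatingSign] at h1
  have h3 : ∑ t ∈ range (b + b), alternatingSign c (a + t) = 0 ∨
      ∑ t ∈ range (b + b), alternatingSign c (a + t) = 2 := by
    split_ifs at h1 <;> omega
  rcases h3 with h3 | h3 <;> rw [h3] <;> rfl

theorem exists_extremal_coloring_odd {k h : ℕ} (hh : 1 ≤ h) (m : Fin k → ℕ)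
    (hm : ∑ i, m i = 2 * h + 1) :
    ∃ f : Fin (2 * h + 1) → Fin k, ∀ i, (colorClass f i).card = m i ∧
      8 * (wienerSet (SimpleGraph.cycleGraph (2 * h + 1)) (colorClass f i) : ℤ) =
        cycleBound (2 * h + 1) (m i) := by
  -- The classes are consecutive blocks of lengths `m i` in the ordering `oddOrder`.
  let e : (Σ i, Fin (m i)) ≃ Fin (2 * h + 1) := finSigmaFinEquiv.trans (finCongr hm)
  let f : Fin (2 * h + 1) → Fin k := fun v => (e.symm (oddOrder h v)).1
  have hsum : ∀ i, ∃ a, ∀ g : ℕ → ℤ, ∑ v ∈ colorClass f i, g (oddOrder h v) =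
      ∑ t ∈ range (m i), g (a + t) := by
    intro i
    refine ⟨∑ j : Fin i, m (Fin.castLE i.2.le j), fun g => ?_⟩
    rw [sum_colorClass, (oddOrder_bijective h).sum_comp
      (fun w => if (e.symm w).1 = i then g w else 0), ← e.sum_comp, Fintype.sum_sigma,
      sum_eq_single i, ← Fin.sum_univ_eq_sum_range (fun t => g (_ + t))]
    · refine sum_congr rfl fun t _ => ?_
      simp only [Equiv.symm_apply_apply, if_true]
      congr 1
      exact finSigmaFinEquiv_apply ⟨i, t⟩
    · intro j _ hj
      simp [hj]
    · simp
  have hcard : ∀ i, (colorClass f i).card = m i := by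
    intro i
    obtain ⟨a, ha⟩ := hsum i
    have := ha fun _ => 1
    simp only [sum_const, card_range, nsmul_eq_mul, mul_one] at this
    exact_mod_cast this
  have hsign : ∀ i, ∃ a, ∀ s, ∃ c, ∑ v ∈ colorClass f i, arcSign s v =
      ∑ t ∈ range (colorClass f i).card, alternatingSign c (a + t) := by
    intro i
    obtain ⟨a, ha⟩ := hsum i
    refine ⟨a, fun s => ?_⟩
    obtain ⟨c, hc⟩ := exists_arcSign_eq_alternatingSign hh s
    exact ⟨c, by rw [hcard, ← ha, sum_congr rfl fun v _ => hc v]⟩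
  refine ⟨f, fun i => ⟨hcard i, ?_⟩⟩
  obtain ⟨a, ha⟩ := hsign i
  rw [← hcard i]
  refine eight_mul_wienerSet_eq _ (fun ho s => ?_) (fun he s => ?_)
  · obtain ⟨c, hc⟩ := ha s
    rw [hc, sum_alternatingSign_odd c a ho]
  · obtain ⟨c, hc⟩ := ha s
    rw [hc, sum_alternatingSign_even c a he]

/-- For all prescribed class sizes there is a coloring of the cycle all of whose classes attain the
largest Wiener index for their size. -/
theorem exists_extremal_coloring {n k : ℕ} (hn : 2 ≤ n) (m : Fin k → ℕ) (hm : ∑ i, m i = n) :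
    ∃ f : Fin n → Fin k, ∀ i, (colorClass f i).card = m i ∧
      8 * (wienerSet (SimpleGraph.cycleGraph n) (colorClass f i) : ℤ) = cycleBound n (m i) := by
  rcases Nat.even_or_odd n with ⟨h, rfl⟩ | ⟨h, rfl⟩
  · exact exists_extremal_coloring_even m hm
  · exact exists_extremal_coloring_odd (by omega) m hm

/-! ### Convexity of the bound -/

theorem cycleBound_succ_sub_of_odd {n m : ℕ} (hm : Odd m) :
    cycleBound n (m + 1) - cycleBound n m = 2 * ((n : ℤ) - (n % 2 : ℕ)) * (m + 1) := by
  have h1 : ¬ Odd (m + 1) := by rw [Nat.not_odd_iff_even]; exact hm.add_one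
  rw [cycleBound, cycleBound, if_neg h1, if_pos hm]
  push_cast
  ring

theorem cycleBound_succ_sub_of_even {n m : ℕ} (hm : Even m) :
    cycleBound n (m + 1) - cycleBound n m = 2 * ((n : ℤ) + (n % 2 : ℕ)) * m := by
  have h1 : ¬ Odd m := Nat.not_odd_iff_even.2 hm
  rw [cycleBound, cycleBound, if_neg h1, if_pos hm.add_one]
  push_cast
  ring

/-- The tight case is `n` odd, `m` even: `(n + 1) m ≤ (n - 1)(m + 2)` amounts to `m ≤ n - 1`. -/
theorem cycleBound_convex_step {n m : ℕ} (hmn : m + 2 ≤ n) :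
    cycleBound n (m + 1) - cycleBound n m ≤ cycleBound n (m + 1 + 1) - cycleBound n (m + 1) := by
  have hr : ((n % 2 : ℕ) : ℤ) = 0 ∨ ((n % 2 : ℕ) : ℤ) = 1 := by omega
  zify at hmn
  rcases Nat.even_or_odd m with h | h
  · rw [cycleBound_succ_sub_of_even h, cycleBound_succ_sub_of_odd h.add_one]
    push_cast at hr ⊢
    rcases hr with hr | hr <;> rw [hr] <;> nlinarith
  · rw [cycleBound_succ_sub_of_odd h, cycleBound_succ_sub_of_even h.add_one]
    push_cast at hr ⊢
    rcases hr with hr | hr <;> rw [hr] <;> nlinarith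

theorem cycleBound_sub_mono {n a b : ℕ} (hab : a ≤ b) (hb : b + 1 ≤ n) :
    cycleBound n (a + 1) - cycleBound n a ≤ cycleBound n (b + 1) - cycleBound n b := by
  induction b, hab using Nat.le_induction with
  | base => rfl
  | succ b _ ih => exact (ih (by omega)).trans (cycleBound_convex_step hb)

/-- Convexity: the graph of `cycleBound n` lies above its chords through consecutive points. -/
theorem cycleBound_tangent {n q x : ℕ} (hq : q + 1 ≤ n) (hx : x ≤ n) :
    cycleBound n q + ((x : ℤ) - q) * (cycleBound n (q + 1) - cycleBound n q) ≤ cycleBound n x := by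
  rcases le_total q x with h | h
  · induction x, h using Nat.le_induction with
    | base => simp
    | succ x hqx ih =>
      have h1 := ih (by omega)
      have h2 := cycleBound_sub_mono hqx hx
      push_cast
      linarith
  · induction h using Nat.decreasingInduction with
    | self => simp
    | of_succ x hxq ih =>
      have h1 := ih (by omega)
      have h2 := cycleBound_sub_mono (n := n) hxq.le hq
      push_cast at h1
      linarith

theorem cycleBound_transfer_lt_of_odd {n a b : ℕ} (hn : Odd n) (ha : 1 ≤ a) (hab : a + 2 ≤ b)
    (hb : b ≤ n) :
    cycleBound n (b - 1) + cycleBound n (a + 1) < cycleBound n b + cycleBound n a := by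
  obtain ⟨c, rfl⟩ : ∃ c, b = c + 1 := ⟨b - 1, by omega⟩
  have h1 : cycleBound n (a + 1) - cycleBound n a <
      cycleBound n (a + 1 + 1) - cycleBound n (a + 1) := by
    have hr : ((n % 2 : ℕ) : ℤ) = 1 := by rw [Nat.odd_iff.1 hn]; rfl
    have han : (a : ℤ) + 2 ≤ n := by omega
    zify at ha
    rcases Nat.even_or_odd a with h | h
    · rw [cycleBound_succ_sub_of_even h, cycleBound_succ_sub_of_odd h.add_one, hr]
      push_cast
      nlinarith
    · rw [cycleBound_succ_sub_of_odd h, cycleBound_succ_sub_of_even h.add_one, hr]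
      push_cast
      nlinarith
  have h2 := cycleBound_sub_mono (n := n) (a := a + 1) (b := c) (by omega) hb
  rw [Nat.add_sub_cancel]
  linarith

/-- For even `n` the increments grow strictly from each even `m` to `m + 1`. An even `m` with `a ≤ m
< b - 1` exists except in the excluded case. -/
theorem cycleBound_transfer_lt_of_even {n a b : ℕ} (hn : Even n) (hab : a + 2 ≤ b)
    (hb : b ≤ n) (h : ¬ (b = a + 2 ∧ Odd a)) :
    cycleBound n (b - 1) + cycleBound n (a + 1) < cycleBound n b + cycleBound n a := by
  obtain ⟨c, rfl⟩ : ∃ c, b = c + 1 := ⟨b - 1, by omega⟩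
  have hr : ((n % 2 : ℕ) : ℤ) = 0 := by rw [Nat.even_iff.1 hn]; rfl
  have hn0 : (2 : ℤ) ≤ n := by omega
  have hlt : ∀ m, Even m → cycleBound n (m + 1) - cycleBound n m <
      cycleBound n (m + 1 + 1) - cycleBound n (m + 1) := by
    intro m hm
    rw [cycleBound_succ_sub_of_even hm, cycleBound_succ_sub_of_odd hm.add_one, hr]
    push_cast
    nlinarith
  rw [Nat.add_sub_cancel]
  rcases Nat.even_or_odd a with ha | ha
  · have h1 := hlt a ha
    have h2 := cycleBound_sub_mono (n := n) (a := a + 1) (b := c) (by omega) hb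
    linarith
  · have hc : a + 2 ≤ c := by
      have : ¬ (c + 1 = a + 2) := fun h0 => h ⟨h0, ha⟩
      omega
    have h1 := hlt (a + 1) ha.add_one
    have h2 := cycleBound_sub_mono (n := n) (a := a + 1 + 1) (b := c) (by omega) hb
    have h3 := cycleBound_convex_step (n := n) (m := a) (by omega)
    linarith

theorem cycleBound_even_transfer {n m : ℕ} (hn : Even n) (hm : Even (m + 1)) :
    cycleBound n m + cycleBound n (m + 1 + 1) = 2 * cycleBound n (m + 1) := by
  have h := Nat.even_add_one.1 hm
  have hr : ((n % 2 : ℕ) : ℤ) = 0 := by rw [Nat.even_iff.1 hn]; rfl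
  have h1 := cycleBound_succ_sub_of_odd (n := n) (Nat.not_even_iff_odd.1 h)
  have h2 := cycleBound_succ_sub_of_even (n := n) hm
  rw [hr] at h1 h2
  push_cast at h2
  linarith

/-! ### Transfers, sorting and the closure -/

theorem sum_comp_transfer {k : ℕ} (g : ℤ → ℤ) (x : Fin k → ℤ) {j j' : Fin k} (h : j ≠ j') :
    ∑ l, g ((x - Pi.single j 1 + Pi.single j' 1 : Fin k → ℤ) l) + (g (x j) + g (x j')) =
      ∑ l, g (x l) + (g (x j - 1) + g (x j' + 1)) := by
  have hs : ∀ y : Fin k → ℤ, ∑ l, g (y l) = g (y j) + g (y j') +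
      ∑ l ∈ (univ.erase j).erase j', g (y l) := by
    intro y
    rw [← add_sum_erase univ _ (mem_univ j),
      ← add_sum_erase (univ.erase j) _ (mem_erase.2 ⟨h.symm, mem_univ j'⟩), add_assoc]
  rw [hs, hs x]
  have h0 : ∑ l ∈ (univ.erase j).erase j', g ((x - Pi.single j 1 + Pi.single j' 1 : Fin k → ℤ) l) =
      ∑ l ∈ (univ.erase j).erase j', g (x l) := by
    refine sum_congr rfl fun l hl => ?_
    simp only [mem_erase] at hl
    simp [hl.1, hl.2.1]
  rw [h0]
  simp [h, h.symm]
  ring_nf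

theorem sum_comp_sortUp {k : ℕ} (g : ℤ → ℤ) (x : Fin k → ℤ) :
    ∑ i, g (sortUp x i) = ∑ i, g (x i) :=
  Equiv.sum_comp (Tuple.sort x) fun i => g (x i)

theorem monotone_sortUp {k : ℕ} (x : Fin k → ℤ) : Monotone (sortUp x) := Tuple.monotone_sort x

theorem sortUp_comp_perm {k : ℕ} (x : Fin k → ℤ) (σ : Equiv.Perm (Fin k)) :
    sortUp (x ∘ σ) = sortUp x := Tuple.comp_perm_comp_sort_eq_comp_sort

theorem sortUp_of_monotone {k : ℕ} {x : Fin k → ℤ} (hx : Monotone x) : sortUp x = x := by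
  rw [sortUp, Tuple.sort_eq_refl_iff_monotone.2 hx]
  rfl

theorem mem_evenTransferClosure_of_mem {k : ℕ} {T : Set (Fin k → ℤ)} {t : Fin k → ℤ}
    (hm : Monotone t) (h : t ∈ T) : t ∈ evenTransferClosure T :=
  Set.mem_iUnion.2 ⟨0, hm, Or.inl h⟩

theorem transfer_mem_evenTransferClosure {k : ℕ} {T : Set (Fin k → ℤ)} {t : Fin k → ℤ}
    (h : t ∈ evenTransferClosure T) {j j' : Fin k} (hj : j ≤ j') (he : Even (t j))
    (hjj : t j = t j') : transfer j j' t ∈ evenTransferClosure T := by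
  obtain ⟨l, hl⟩ := Set.mem_iUnion.1 h
  refine Set.mem_iUnion.2 ⟨l + 1, ?_⟩
  rw [Function.iterate_succ_apply']
  exact ⟨monotone_sortUp _, Or.inr ⟨t, hl, j, j', hj, he, hjj, rfl⟩⟩

theorem evenTransferClosure_induction {k : ℕ} {T : Set (Fin k → ℤ)} {p : (Fin k → ℤ) → Prop}
    (hbase : ∀ t ∈ T, p t) (hstep : ∀ t, p t → ∀ j j', j ≤ j' → Even (t j) → t j = t j' →
      p (transfer j j' t)) {s : Fin k → ℤ} (hs : s ∈ evenTransferClosure T) : p s := by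
  have hiter : ∀ l, ∀ s ∈ evenTransferStep^[l] T, p s := by
    intro l
    induction l with
    | zero => exact hbase
    | succ l ih =>
      intro s hs
      rw [Function.iterate_succ_apply'] at hs
      obtain ⟨-, hs | ⟨t, ht, j, j', hj, he, hjj, rfl⟩⟩ := hs
      · exact ih s hs
      · exact hstep t (ih t ht) j j' hj he hjj
  obtain ⟨l, hl⟩ := Set.mem_iUnion.1 hs
  exact hiter _ s hl

/-- The total of the bounds for a tuple of class sizes. -/
def tupleBound (n : ℕ) {k : ℕ} (x : Fin k → ℤ) : ℤ := ∑ i, cycleBound n (x i).toNat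

theorem tupleBound_sortUp (n : ℕ) {k : ℕ} (x : Fin k → ℤ) :
    tupleBound n (sortUp x) = tupleBound n x :=
  sum_comp_sortUp (fun z => cycleBound n z.toNat) x

theorem sum_transfer {k : ℕ} (x : Fin k → ℤ) (j j' : Fin k) :
    ∑ l, (x - Pi.single j 1 + Pi.single j' 1 : Fin k → ℤ) l = ∑ l, x l := by
  simp [sum_add_distrib, sum_sub_distrib]

/-- A positive even entry is at least `2`, so it stays positive after losing one; the bound is
preserved because `cycleBound n` is affine around even arguments. -/
theorem transfer_mem_properties {n k : ℕ} (hn : Even n) {t : Fin k → ℤ} (hpos : ∀ i, 0 < t i)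
    {j j' : Fin k} (he : Even (t j)) (hjj : t j = t j') :
    (∀ i, 0 < transfer j j' t i) ∧ tupleBound n (transfer j j' t) = tupleBound n t := by
  rcases eq_or_ne j j' with rfl | hne
  · have h0 : t - Pi.single j 1 + Pi.single j 1 = t := sub_add_cancel _ _
    rw [transfer, h0, tupleBound_sortUp]
    exact ⟨fun i => hpos _, rfl⟩
  · constructor
    · intro i
      rw [transfer, sortUp, Function.comp_apply]
      generalize Tuple.sort (t - Pi.single j 1 + Pi.single j' 1) i = l
      have hl := hpos l
      have : 2 ≤ t j := by have := hpos j; obtain ⟨a, ha⟩ := he; omega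
      simp only [Pi.add_apply, Pi.sub_apply, Pi.single_apply]
      split_ifs with h1 h2 h2
      · omega
      · subst h1; omega
      · omega
      · omega
    · rw [transfer, tupleBound_sortUp]
      have h := sum_comp_transfer (fun z => cycleBound n z.toNat) t hne
      obtain ⟨m, hm⟩ : ∃ m : ℕ, t j = m + 1 := ⟨(t j - 1).toNat, by have := hpos j; omega⟩
      have hm' : Even (m + 1) := by rw [hm] at he; exact_mod_cast he
      have h2 := cycleBound_even_transfer hn hm'
      rw [← hjj, hm] at h
      have e1 : ((m : ℤ) + 1).toNat = m + 1 := by omega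
      have e2 : ((m : ℤ) + 1 - 1).toNat = m := by omega
      have e3 : ((m : ℤ) + 1 + 1).toNat = m + 1 + 1 := by omega
      simp only [e1, e2, e3] at h
      unfold tupleBound
      linarith

theorem tupleBound_of_mem_evenTransferClosure {n k : ℕ} (hn : Even n) (hk : 1 ≤ k) (hkn : k ≤ n)
    {s : Fin k → ℤ} (hs : s ∈ evenTransferClosure {equitableTuple n k}) :
    tupleBound n s = tupleBound n (equitableTuple n k) := by
  refine (evenTransferClosure_induction (p := fun s => (∀ i, 0 < s i) ∧
    tupleBound n s = tupleBound n (equitableTuple n k)) ?_ ?_ hs).2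
  · rintro t rfl
    exact ⟨((equitableTuple_spec hk hkn _).2 rfl).1, rfl⟩
  · rintro t ⟨hpos, hb⟩ j j' - he hjj
    have h := transfer_mem_properties hn hpos he hjj
    exact ⟨h.1, h.2.trans hb⟩

/-! ### Tuples minimizing the bound -/

/-- Tuples with entries differing by at most one minimize `tupleBound`. -/
theorem tupleBound_le_of_balanced {n k : ℕ} (hk : 2 ≤ k) {x y : Fin k → ℤ}
    (hx : ∀ i, 0 < x i) (hxs : ∑ i, x i = n) (hxd : ∀ i j, |x i - x j| ≤ 1)
    (hy : ∀ i, 0 < y i) (hys : ∑ i, y i = n) : tupleBound n x ≤ tupleBound n y := by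
  -- As `k ≥ 2`, some other positive part keeps every entry below `n`, inside the range of
  -- convexity.
  have hle : ∀ z : Fin k → ℤ, (∀ i, 0 < z i) → ∑ i, z i = n → ∀ i, z i + 1 ≤ n := by
    intro z hz hzs i
    obtain ⟨j, hj⟩ : ∃ j, j ≠ i := by
      have : Nontrivial (Fin k) := Fin.nontrivial_iff_two_le.2 hk
      exact exists_ne i
    have h1 : ∑ l ∈ {i, j}, z l ≤ ∑ l, z l :=
      sum_le_sum_of_subset_of_nonneg (subset_univ _) fun l _ _ => (hz l).le
    rw [sum_pair hj.symm] at h1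
    have := hz j
    omega
  have : Nonempty (Fin k) := ⟨⟨0, by omega⟩⟩
  obtain ⟨i₀, hi₀⟩ := Finite.exists_min x
  obtain ⟨q, hq⟩ : ∃ q : ℕ, x i₀ = q := ⟨(x i₀).toNat, by have := hx i₀; omega⟩
  have hqn : q + 1 ≤ n := by have := hle x hx hxs i₀; omega
  set D := cycleBound n (q + 1) - cycleBound n q with hD
  -- Compare with the chord through `q` and `q + 1`, where `q` is the least entry of `x`: it is
  -- exact on `x`, lies below the bound on `y`, and its total depends only on the sum.
  have hlin : ∀ z : Fin k → ℤ, ∑ i, z i = n →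
      ∑ i, (cycleBound n q + (z i - q) * D) = k * cycleBound n q + (n - k * q) * D := by
    intro z hz
    rw [sum_add_distrib, ← sum_mul, sum_sub_distrib, hz]
    simp
  calc tupleBound n x = ∑ i, (cycleBound n q + (x i - q) * D) := sum_congr rfl fun i _ => by
        have h1 := hi₀ i
        have h2 := abs_le.1 (hxd i i₀)
        have h3 : x i = q ∨ x i = q + 1 := by omega
        rcases h3 with h3 | h3
        · rw [h3]; simp
        · have e : ((q : ℤ) + 1).toNat = q + 1 := by omega
          rw [h3, e, hD]; ring
    _ = ∑ i, (cycleBound n q + (y i - q) * D) := by rw [hlin x hxs, hlin y hys]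
    _ ≤ tupleBound n y := sum_le_sum fun i _ => by
        have h1 := hle y hy hys i
        have h2 := hy i
        have h3 := cycleBound_tangent hqn (x := (y i).toNat) (by omega)
        rwa [Int.toNat_of_nonneg h2.le] at h3

/-- A minimal tuple admits no improving transfer. -/
theorem cycleBound_transfer_ge_of_minimal {n k : ℕ} {x : Fin k → ℤ} (hx : ∀ i, 0 < x i)
    (hxs : ∑ i, x i = n) (hmin : ∀ y : Fin k → ℤ, (∀ i, 0 < y i) → ∑ i, y i = n →
      tupleBound n x ≤ tupleBound n y) {i j : Fin k} (hij : x j + 2 ≤ x i) :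
    cycleBound n (x i).toNat + cycleBound n (x j).toNat ≤
      cycleBound n ((x i).toNat - 1) + cycleBound n ((x j).toNat + 1) := by
  have hne : i ≠ j := by rintro rfl; omega
  have h1 := sum_comp_transfer (fun z => cycleBound n z.toNat) x hne
  have h2 := hmin (x - Pi.single i 1 + Pi.single j 1) (fun l => by
    have := hx l; have := hx j
    simp only [Pi.add_apply, Pi.sub_apply, Pi.single_apply]
    split_ifs with h1 h2 h2
    · omega
    · subst h1; omega
    · omega
    · omega) (by rw [sum_transfer, hxs])
  have e1 : (x i - 1).toNat = (x i).toNat - 1 := by omega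
  have e2 : (x j + 1).toNat = (x j).toNat + 1 := by have := hx j; omega
  simp only [e1, e2] at h1
  unfold tupleBound at h2
  linarith

theorem le_of_sum_eq {n k : ℕ} {x : Fin k → ℤ} (hx : ∀ i, 0 < x i) (hxs : ∑ i, x i = n)
    (i : Fin k) : x i ≤ n := by
  rw [← hxs]
  exact single_le_sum (fun l _ => (hx l).le) (mem_univ i)

theorem balanced_of_minimal_odd {n k : ℕ} (hn : Odd n) {x : Fin k → ℤ} (hx : ∀ i, 0 < x i)
    (hxs : ∑ i, x i = n) (hmin : ∀ y : Fin k → ℤ, (∀ i, 0 < y i) → ∑ i, y i = n →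
      tupleBound n x ≤ tupleBound n y) (i j : Fin k) : |x i - x j| ≤ 1 := by
  have key : ∀ i j, x i ≤ x j + 1 := by
    intro i j
    by_contra! hlt
    have h1 := cycleBound_transfer_ge_of_minimal hx hxs hmin (i := i) (j := j) (by omega)
    have := hx i; have := hx j; have := le_of_sum_eq hx hxs i
    have h2 := cycleBound_transfer_lt_of_odd hn (a := (x j).toNat) (b := (x i).toNat)
      (by omega) (by omega) (by omega)
    omega
  have := key i j; have := key j i
  rw [abs_le]; omega

theorem near_balanced_of_minimal_even {n k : ℕ} (hn : Even n) {x : Fin k → ℤ} (hx : ∀ i, 0 < x i)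
    (hxs : ∑ i, x i = n) (hmin : ∀ y : Fin k → ℤ, (∀ i, 0 < y i) → ∑ i, y i = n →
      tupleBound n x ≤ tupleBound n y) (i j : Fin k) :
    x i ≤ x j + 1 ∨ (x i = x j + 2 ∧ Odd (x j)) := by
  by_contra! hlt
  have h1 := cycleBound_transfer_ge_of_minimal hx hxs hmin (i := i) (j := j) (by omega)
  have := hx i; have := hx j; have := le_of_sum_eq hx hxs i
  have h2 := cycleBound_transfer_lt_of_even hn (a := (x j).toNat) (b := (x i).toNat)
    (by omega) (by omega) (by
      rintro ⟨h3, h4⟩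
      refine hlt.2 (by omega) ?_
      have h5 : ((x j).toNat : ℤ) = x j := by omega
      rw [← h5]; exact_mod_cast h4)
  omega

/-- Two entries `a`, `a + 2` with `a` odd can be merged into `a + 1`, `a + 1`, which lowers the sum
of squares by `2`. By induction the merged tuple is in the closure, and an even transfer undoes the
merge. -/
theorem mem_evenTransferClosure_of_near_balanced {n k : ℕ} (hk : 1 ≤ k) (hkn : k ≤ n)
    {x : Fin k → ℤ} (hmono : Monotone x) (hx : ∀ i, 0 < x i) (hxs : ∑ i, x i = n)
    (hnear : ∀ i j, x i ≤ x j + 1 ∨ (x i = x j + 2 ∧ Odd (x j))) :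
    x ∈ evenTransferClosure {equitableTuple n k} := by
  induction hN : (∑ i, x i ^ 2).toNat using Nat.strong_induction_on generalizing x with
  | _ N ih =>
  by_cases hbal : ∀ i j, x i ≤ x j + 1
  · refine mem_evenTransferClosure_of_mem hmono ?_
    exact (equitableTuple_spec hk hkn x).1 ⟨hx, hxs, hmono, fun i j => by
      have := hbal i j; have := hbal j i
      rw [abs_le]; omega⟩
  push Not at hbal
  obtain ⟨i, j, hij⟩ := hbal
  obtain ⟨hij2, hodd⟩ : x i = x j + 2 ∧ Odd (x j) := (hnear i j).resolve_left (by omega)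
  have hne : i ≠ j := by rintro rfl; omega
  -- So `x j` is the least entry and `x i` the greatest, which keeps the merged tuple near balanced.
  have hrange : ∀ l, x j ≤ x l ∧ x l ≤ x j + 2 := by
    intro l
    have h1 := hnear i l
    have h2 := hnear l j
    omega
  set y := x - Pi.single i 1 + Pi.single j 1 with hy
  have hyi : y i = x j + 1 := by simp [hy, hne]; omega
  have hyj : y j = x j + 1 := by simp [hy, hne.symm]
  have hyl : ∀ l, l ≠ i → l ≠ j → y l = x l := by intro l h1 h2; simp [hy, h1, h2]
  have hyrange : ∀ l, x j ≤ y l ∧ y l ≤ x j + 2 := by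
    intro l
    by_cases h1 : l = i
    · subst h1; omega
    by_cases h2 : l = j
    · subst h2; omega
    rw [hyl l h1 h2]; exact hrange l
  have hmem : sortUp y ∈ evenTransferClosure {equitableTuple n k} := by
    refine ih _ ?_ (monotone_sortUp y) (fun l => ?_) ?_ (fun p q => ?_) rfl
    · rw [← hN, sum_comp_sortUp (fun z => z ^ 2) y]
      have h1 := sum_comp_transfer (fun z => z ^ 2) x hne
      beta_reduce at h1
      rw [← hy, hij2] at h1
      have h2 : ∑ l, y l ^ 2 + 2 = ∑ l, x l ^ 2 := by linarith
      have h3 : 0 ≤ ∑ l, y l ^ 2 := sum_nonneg fun l _ => sq_nonneg _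
      omega
    · have := (hyrange (Tuple.sort y l)).1
      have := hx j
      rw [sortUp, Function.comp_apply]; omega
    · rw [sum_comp_sortUp (fun z => z) y, hy, sum_transfer, hxs]
    · simp only [sortUp, Function.comp_apply]
      have h1 := hyrange (Tuple.sort y p)
      have h2 := hyrange (Tuple.sort y q)
      by_cases h3 : y (Tuple.sort y p) ≤ y (Tuple.sort y q) + 1
      · exact Or.inl h3
      · have h4 : y (Tuple.sort y q) = x j := by omega
        exact Or.inr ⟨by omega, by rw [h4]; exact hodd⟩
  have hback : ∀ p q : Fin k, p ≤ q → y (Tuple.sort y p) = x j + 1 →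
      y (Tuple.sort y q) = x j + 1 →
      (∃ τ : Equiv.Perm (Fin k), y - Pi.single (Tuple.sort y p) 1 + Pi.single (Tuple.sort y q) 1 =
        x ∘ τ) → x ∈ evenTransferClosure {equitableTuple n k} := by
    rintro p q hpq hp hq ⟨τ, hτ⟩
    have h1 := transfer_mem_evenTransferClosure hmem hpq
      (by rw [sortUp, Function.comp_apply, hp]; exact hodd.add_one)
      (by rw [sortUp, Function.comp_apply, Function.comp_apply, hp, hq])
    have h2 : sortUp y - Pi.single p 1 + Pi.single q 1 =
        (y - Pi.single (Tuple.sort y p) 1 + Pi.single (Tuple.sort y q) 1) ∘ Tuple.sort y := by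
      funext l
      simp [sortUp, Pi.single_apply]
    rwa [transfer, h2, sortUp_comp_perm, hτ, sortUp_comp_perm, sortUp_of_monotone hmono] at h1
  -- A transfer must go from the earlier to the later index, and sorting may put the equal entries
  -- at `i` and `j` in either order. One order restores `x`, the other restores it with `i` and `j`
  -- swapped.
  rcases le_total ((Tuple.sort y).symm j) ((Tuple.sort y).symm i) with h | h
  · refine hback _ _ h (by simpa using hyj) (by simpa using hyi) ⟨Equiv.refl _, ?_⟩
    simp only [Equiv.apply_symm_apply, hy]
    funext l
    simp
  · refine hback _ _ h (by simpa using hyi) (by simpa using hyj) ⟨Equiv.swap i j, ?_⟩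
    simp only [Equiv.apply_symm_apply]
    funext l
    simp only [Pi.add_apply, Pi.sub_apply, Function.comp_apply]
    by_cases h1 : l = i
    · subst h1
      rw [hyi, Equiv.swap_apply_left]; simp [hne]
    by_cases h2 : l = j
    · subst h2
      rw [hyj, Equiv.swap_apply_right]; simp [hne.symm]; omega
    rw [hyl l h1 h2, Equiv.swap_apply_of_ne_of_ne h1 h2]
    simp [h1, h2]

/-! ### From tuples back to colorings -/

theorem eight_mul_wiener_le {n k : ℕ} (f : Fin n → Fin k) :
    8 * (wiener (SimpleGraph.cycleGraph n) f : ℤ) ≤ tupleBound n (colorType f) := by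
  rw [colorType, tupleBound_sortUp, wiener, Nat.cast_sum, mul_sum, tupleBound]
  refine sum_le_sum fun i _ => ?_
  rw [Int.toNat_natCast]
  exact eight_mul_wienerSet_le _

theorem card_colorClass_pos {n k : ℕ} {f : Fin n → Fin k} :
    (∀ i, 0 < (colorClass f i).card) ↔ Function.Surjective f := by
  refine forall_congr' fun i => ?_
  rw [card_pos]
  simp [Finset.Nonempty, colorClass]

theorem sum_card_colorClass {n k : ℕ} (f : Fin n → Fin k) : ∑ i, (colorClass f i).card = n := by
  have h := card_eq_sum_card_fiberwise (s := univ) (t := univ) (f := f) (fun _ _ => mem_univ _)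
  rw [card_univ, Fintype.card_fin] at h
  exact h.symm

/-- Every tuple of positive class sizes is realized by a weak maximizer attaining the bound. -/
theorem exists_weakMaximizer {n k : ℕ} (hn : 2 ≤ n) {x : Fin k → ℤ} (hx : ∀ i, 0 < x i)
    (hxs : ∑ i, x i = n) :
    ∃ f ∈ weakMaximizers (SimpleGraph.cycleGraph n) k, colorType f = sortUp x ∧
      8 * (wiener (SimpleGraph.cycleGraph n) f : ℤ) = tupleBound n x := by
  have hnat : ∀ i, ((x i).toNat : ℤ) = x i := fun i => Int.toNat_of_nonneg (hx i).le
  obtain ⟨f, hf⟩ := exists_extremal_coloring hn (fun i => (x i).toNat) (by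
    zify; simp only [hnat, hxs])
  have htype : colorType f = sortUp x := by
    rw [colorType]
    congr 1
    funext i
    rw [(hf i).1, hnat]
  have hw : 8 * (wiener (SimpleGraph.cycleGraph n) f : ℤ) = tupleBound n x := by
    rw [wiener, Nat.cast_sum, mul_sum]
    exact sum_congr rfl fun i _ => (hf i).2
  refine ⟨f, ⟨card_colorClass_pos.1 fun i => ?_, fun f' _ h' => ?_⟩, htype, hw⟩
  · rw [(hf i).1]; have := hx i; omega
  · have h1 := eight_mul_wiener_le f'
    rw [h', htype, tupleBound_sortUp] at h1
    omega

/-- A weak maximizer does at least as well as the extremal coloring of its own type, which already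
attains the upper bound. -/
theorem eight_mul_wiener_of_weakMaximizer {n k : ℕ} (hn : 2 ≤ n) {f : Fin n → Fin k}
    (hf : f ∈ weakMaximizers (SimpleGraph.cycleGraph n) k) :
    8 * (wiener (SimpleGraph.cycleGraph n) f : ℤ) =
      tupleBound n fun i => ((colorClass f i).card : ℤ) := by
  obtain ⟨g, hg, htype, hw⟩ := exists_weakMaximizer hn
    (x := fun i => ((colorClass f i).card : ℤ))
    (fun i => by exact_mod_cast card_colorClass_pos.2 hf.1 i)
    (by exact_mod_cast sum_card_colorClass f)
  have h1 := hf.2 g hg.1 htype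
  have h2 := eight_mul_wiener_le f
  rw [colorType, tupleBound_sortUp] at h2
  omega

/-- This removes the graph: every positive tuple with sum `n` comes from a weak maximizer, whose
Wiener index is fixed by its class sizes. -/
theorem isLeast_wiener_iff {n k : ℕ} (hn : 2 ≤ n) {f : Fin n → Fin k}
    (hf : f ∈ weakMaximizers (SimpleGraph.cycleGraph n) k) :
    IsLeast (wiener (SimpleGraph.cycleGraph n) '' weakMaximizers (SimpleGraph.cycleGraph n) k)
      (wiener (SimpleGraph.cycleGraph n) f) ↔
    ∀ y : Fin k → ℤ, (∀ i, 0 < y i) → ∑ i, y i = n →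
      tupleBound n (fun i => ((colorClass f i).card : ℤ)) ≤ tupleBound n y := by
  rw [← eight_mul_wiener_of_weakMaximizer hn hf]
  constructor
  · rintro ⟨-, h⟩ y hy hys
    obtain ⟨g, hg, -, hw⟩ := exists_weakMaximizer hn hy hys
    have := h ⟨g, hg, rfl⟩
    omega
  · refine fun h => ⟨⟨f, hf, rfl⟩, ?_⟩
    rintro _ ⟨g, hg, rfl⟩
    have h1 := h (fun i => ((colorClass g i).card : ℤ))
      (fun i => by exact_mod_cast card_colorClass_pos.2 hg.1 i)
      (by exact_mod_cast sum_card_colorClass g)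
    rw [← eight_mul_wiener_of_weakMaximizer hn hg] at h1
    omega

theorem mainTheorem7 (n k : ℕ) (hk : 2 ≤ k) (hkn : k ≤ n) (f : Fin n → Fin k)
    (hf : f ∈ weakMaximizers (SimpleGraph.cycleGraph n) k) :
    (Even n →
      (IsLeast (wiener (SimpleGraph.cycleGraph n) '' weakMaximizers (SimpleGraph.cycleGraph n) k)
          (wiener (SimpleGraph.cycleGraph n) f) ↔
        colorType f ∈ evenTransferClosure {equitableTuple n k})) ∧
    (Odd n →
      (IsLeast (wiener (SimpleGraph.cycleGraph n) '' weakMaximizers (SimpleGraph.cycleGraph n) k)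
          (wiener (SimpleGraph.cycleGraph n) f) ↔
        ∀ i j : Fin k, |((colorClass f i).card : ℤ) - ((colorClass f j).card : ℤ)| ≤ 1)) := by
  have hpos : ∀ i, (0 : ℤ) < (colorClass f i).card := fun i => by
    exact_mod_cast card_colorClass_pos.2 hf.1 i
  have hsum : ∑ i, ((colorClass f i).card : ℤ) = n := by exact_mod_cast sum_card_colorClass f
  rw [isLeast_wiener_iff (hk.trans hkn) hf]
  refine ⟨fun hn => ⟨fun hmin => ?_, fun hmem y hy hys => ?_⟩,
    fun hn => ⟨fun hmin => balanced_of_minimal_odd hn hpos hsum hmin,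
      fun hbal y hy hys => tupleBound_le_of_balanced hk hpos hsum hbal hy hys⟩⟩
  · exact mem_evenTransferClosure_of_near_balanced (by omega) hkn (monotone_sortUp _)
      (fun i => hpos _) ((sum_comp_sortUp (fun z => z) _).trans hsum)
      fun i j => near_balanced_of_minimal_even hn hpos hsum hmin _ _
  · obtain ⟨h1, h2, -, h3⟩ := (equitableTuple_spec (by omega) hkn _).2 rfl
    have h4 := tupleBound_of_mem_evenTransferClosure hn (by omega) hkn hmem
    rw [colorType, tupleBound_sortUp] at h4
    rw [h4]
    exact tupleBound_le_of_balanced hk h1 h2 h3 hy hys
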